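/- Let $d\in\{2,3\}$, let $\Omega\subset\mathbb R^d$ be open and bounded, let $X=H^1_0(\Omega)^d$ (the closure in $H^1(\Omega)^d$ of the smooth fields compactly supported in $\Omega$) and $V=\{v\in X:\nabla\cdot v=0\}$, with dual space $V^*$. Let $(\cdot,\cdot)$ and $\|\cdot\|$ be the $L^2(\Omega)$ inner product and norm. For $\nu>0$, $u,w,v\in X$ and $f\in V^*$ put $$a(u,v)=(\nu\nabla u,\nabla v),\qquad b(u,w,v)=((u\cdot\nabla)w,v),\qquad \|f\|_*=\sup_{0\ne v\in V}\frac{\langle f,v\rangle}{\|\nabla v\|}$$ (with $\|f\|_*=0$ if $V=\{0\}$). There are positive constants $M,M_1$, depending only on $\Omega$, such that for all $u,w,v\in X$ $$b(u,w,v)\le M\|\nabla u\|\,\|\nabla w\|\,\|\nabla v\|,\qquad b(u,w,v)\le M_1\|u\|^{1/2}\|\nabla u\|^{1/2}\|\nabla w\|\,\|\nabla v\|. \tag{1}$$ Let $M,M_1>0$ be any constants for which (1) holds, let $\nu>0$, $f\in V^*$, $\alpha=M\nu^{-2}\|f\|_*$, and let $u\in V$ be a weak solution of the steady Navier--Stokes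 equations (NSE), that is, $$a(u,v)+b(u,u,v)=\langle f,v\rangle\qquad\text{for all }v\in V.$$ Let $C_I>0$, $H>0$, $\mu\ge 0$, and let $I_H:X\to L^2(\Omega)^d$ be a linear map with $\|I_Hv-v\|\le C_IH\|\nabla v\|$ for all $v\in X$. Consider the nudged (continuous data assimilation, CDA-NSE) problem: find $w\in V$ with $$a(w,v)+b(w,w,v)+\mu\,(I_Hw-I_Hu,I_Hv)=\langle f,v\rangle\qquad\text{for all }v\in V. \tag{2}$$ 1. If $\alpha<1$, then, for every such $H$ and $\mu$, problem (2) has exactly one solution, namely $w=u$. 2. If $\alpha\ge1$ and $$H\le\frac{2M^2}{3\sqrt3\,C_IM_1^2\alpha^2}\qquad\text{and}\qquad \mu\ge\frac{\nu}{4C_I^2H^2},$$ then problem (2) has exactly one solution, namely the observed NSE solution $w=u$. -/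

import Mathlib

open MeasureTheory
open scoped ContDiff

namespace SteadyNSE

/-- `d`-dimensional Euclidean space (points of space, and velocity vectors). -/
abbrev E (d : ℕ) : Type := EuclideanSpace ℝ (Fin d)

/-- Velocity gradients, with the Frobenius inner product; the entry `(i, j)` is `∂ⱼ vᵢ`. -/
abbrev Mat (d : ℕ) : Type := EuclideanSpace ℝ (Fin d × Fin d)

/-- `L²(Ω)^d`. -/
abbrev L2 {d : ℕ} (Ω : Set (E d)) : Type := Lp (E d) 2 (volume.restrict Ω)

/-- `L²(Ω)^{d × d}`. -/
abbrev L2Mat {d : ℕ} (Ω : Set (E d)) : Type := Lp (Mat d) 2 (volume.restrict Ω)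

/-- The `j`-th partial derivative at `x` of a real function on `ℝᵈ`. -/
noncomputable def partialDeriv {d : ℕ} (j : Fin d) (φ : E d → ℝ) (x : E d) : ℝ :=
  fderiv ℝ φ x (EuclideanSpace.single j 1)

/-- The classical gradient of a vector field, with entry `(i, j)` equal to `∂ⱼ φᵢ`. -/
noncomputable def classicalGrad {d : ℕ} (φ : E d → E d) (x : E d) : Mat d :=
  WithLp.toLp 2 fun ij => (fderiv ℝ φ x (EuclideanSpace.single ij.2 1)) ij.1

/-- Smooth functions whose support is a compact subset of `Ω`. -/
structure IsTest {d : ℕ} {F : Type*} [NormedAddCommGroup F] [NormedSpace ℝ F]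
    (Ω : Set (E d)) (φ : E d → F) : Prop where
  smooth : ContDiff ℝ ∞ φ
  compact : HasCompactSupport φ
  support : tsupport φ ⊆ Ω

/-- `G` is the weak gradient of `v` on `Ω`. -/
def IsWeakGrad {d : ℕ} (Ω : Set (E d)) (v : L2 Ω) (G : L2Mat Ω) : Prop :=
  ∀ φ : E d → ℝ, IsTest Ω φ → ∀ i j : Fin d,
    ∫ x in Ω, v x i * partialDeriv j φ x = - ∫ x in Ω, G x (i, j) * φ x

theorem IsTest.add {d : ℕ} {F : Type*} [NormedAddCommGroup F] [NormedSpace ℝ F]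
    {Ω : Set (E d)} {φ ψ : E d → F} (hφ : IsTest Ω φ) (hψ : IsTest Ω ψ) :
    IsTest Ω (φ + ψ) where
  smooth := hφ.smooth.add hψ.smooth
  compact := hφ.compact.add hψ.compact
  support := (tsupport_add φ ψ).trans (Set.union_subset hφ.support hψ.support)

theorem IsTest.smul {d : ℕ} {F : Type*} [NormedAddCommGroup F] [NormedSpace ℝ F]
    {Ω : Set (E d)} {φ : E d → F} (c : ℝ) (hφ : IsTest Ω φ) : IsTest Ω (c • φ) where
  smooth := contDiff_const.smul hφ.smooth
  compact := hφ.compact.smul_left (f := fun _ => c)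
  support := (tsupport_smul_subset_right (fun _ => c) φ).trans hφ.support

theorem IsTest.zero {d : ℕ} {F : Type*} [NormedAddCommGroup F] [NormedSpace ℝ F]
    {Ω : Set (E d)} : IsTest Ω (0 : E d → F) where
  smooth := contDiff_const
  compact := HasCompactSupport.zero
  support := by simp [tsupport]

theorem IsTest.memLp {d : ℕ} {Ω : Set (E d)} {φ : E d → ℝ} (hφ : IsTest Ω φ) :
    MemLp φ 2 (volume.restrict Ω) :=
  (hφ.smooth.continuous.memLp_of_hasCompactSupport hφ.compact).restrict Ω

theorem IsTest.memLp_partialDeriv {d : ℕ} {Ω : Set (E d)} {φ : E d → ℝ} (hφ : IsTest Ω φ)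
    (j : Fin d) : MemLp (partialDeriv j φ) 2 (volume.restrict Ω) := by
  have h1 : Continuous (partialDeriv j φ) :=
    (hφ.smooth.continuous_fderiv (by simp)).clm_apply continuous_const
  have h2 : HasCompactSupport (partialDeriv j φ) := hφ.compact.fderiv_apply ℝ _
  exact (h1.memLp_of_hasCompactSupport h2).restrict Ω

theorem memLp_coord {d : ℕ} {Ω : Set (E d)} {ι : Type*} [Fintype ι]
    (v : Lp (EuclideanSpace ℝ ι) 2 (volume.restrict Ω)) (i : ι) :
    MemLp (fun x => v x i) 2 (volume.restrict Ω) :=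
  (EuclideanSpace.proj (𝕜 := ℝ) i).comp_memLp' (Lp.memLp v)

/-- `H¹(Ω)^d`, each element stored as the pair of a field and its weak gradient. The topology is
the one of `L² × L²`, that is, the `H¹` topology. -/
noncomputable def H1 {d : ℕ} (Ω : Set (E d)) : Submodule ℝ (L2 Ω × L2Mat Ω) where
  carrier := {p | IsWeakGrad Ω p.1 p.2}
  zero_mem' := by
    intro φ _ i j
    have h1 : ∀ᵐ x ∂(volume.restrict Ω), (0 : L2 Ω) x = 0 := Lp.coeFn_zero _ _ _
    have h2 : ∀ᵐ x ∂(volume.restrict Ω), (0 : L2Mat Ω) x = 0 := Lp.coeFn_zero _ _ _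
    rw [integral_eq_zero_of_ae, integral_eq_zero_of_ae, neg_zero]
    · filter_upwards [h2] with x hx
      change (0 : L2Mat Ω) x (i, j) * φ x = 0
      rw [hx, PiLp.zero_apply, zero_mul]
    · filter_upwards [h1] with x hx
      change (0 : L2 Ω) x i * partialDeriv j φ x = 0
      rw [hx, PiLp.zero_apply, zero_mul]
  add_mem' := by
    intro p q hp hq φ hφ i j
    have e1 : ∫ x in Ω, (p + q).1 x i * partialDeriv j φ x =
        ∫ x in Ω, (p.1 x i * partialDeriv j φ x + q.1 x i * partialDeriv j φ x) := by
      refine integral_congr_ae ?_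
      filter_upwards [Lp.coeFn_add p.1 q.1] with x hx
      rw [Prod.fst_add, hx, Pi.add_apply, PiLp.add_apply, add_mul]
    have e2 : ∫ x in Ω, (p + q).2 x (i, j) * φ x =
        ∫ x in Ω, (p.2 x (i, j) * φ x + q.2 x (i, j) * φ x) := by
      refine integral_congr_ae ?_
      filter_upwards [Lp.coeFn_add p.2 q.2] with x hx
      rw [Prod.snd_add, hx, Pi.add_apply, PiLp.add_apply, add_mul]
    rw [e1, e2, integral_add, integral_add, hp φ hφ i j, hq φ hφ i j, neg_add]
    · exact (memLp_coord p.2 (i, j)).integrable_mul hφ.memLp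
    · exact (memLp_coord q.2 (i, j)).integrable_mul hφ.memLp
    · exact (memLp_coord p.1 i).integrable_mul (hφ.memLp_partialDeriv j)
    · exact (memLp_coord q.1 i).integrable_mul (hφ.memLp_partialDeriv j)
  smul_mem' := by
    intro c p hp φ hφ i j
    have e1 : ∫ x in Ω, (c • p).1 x i * partialDeriv j φ x =
        ∫ x in Ω, c * (p.1 x i * partialDeriv j φ x) := by
      refine integral_congr_ae ?_
      filter_upwards [Lp.coeFn_smul c p.1] with x hx
      simp [hx, mul_assoc]
    have e2 : ∫ x in Ω, (c • p).2 x (i, j) * φ x =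
        ∫ x in Ω, c * (p.2 x (i, j) * φ x) := by
      refine integral_congr_ae ?_
      filter_upwards [Lp.coeFn_smul c p.2] with x hx
      simp [hx, mul_assoc]
    rw [e1, e2, integral_const_mul, integral_const_mul, hp φ hφ i j, mul_neg]

/-- The pairs `(φ, ∇φ)` with `φ ∈ C_c^∞(Ω)^d`. -/
noncomputable def testPairs {d : ℕ} (Ω : Set (E d)) : Submodule ℝ (L2 Ω × L2Mat Ω) where
  carrier := {p | ∃ φ : E d → E d, IsTest Ω φ ∧ p.1 =ᵐ[volume.restrict Ω] φ ∧
    p.2 =ᵐ[volume.restrict Ω] classicalGrad φ}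
  zero_mem' := by
    refine ⟨0, IsTest.zero, Lp.coeFn_zero _ _ _, ?_⟩
    filter_upwards [Lp.coeFn_zero (Mat d) 2 (volume.restrict Ω)] with x hx
    refine hx.trans ?_
    ext ij
    simp [classicalGrad]
  add_mem' := by
    rintro p q ⟨φ, hφ, hp1, hp2⟩ ⟨ψ, hψ, hq1, hq2⟩
    refine ⟨φ + ψ, hφ.add hψ, (Lp.coeFn_add p.1 q.1).trans (hp1.add hq1), ?_⟩
    filter_upwards [Lp.coeFn_add p.2 q.2, hp2, hq2] with x hx h1 h2
    refine hx.trans ?_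
    rw [Pi.add_apply, h1, h2]
    ext ij
    simp [classicalGrad, fderiv_add (hφ.smooth.differentiable (by simp) x)
      (hψ.smooth.differentiable (by simp) x)]
  smul_mem' := by
    rintro c p ⟨φ, hφ, hp1, hp2⟩
    refine ⟨c • φ, hφ.smul c, (Lp.coeFn_smul c p.1).trans (hp1.const_smul c), ?_⟩
    filter_upwards [Lp.coeFn_smul c p.2, hp2] with x hx h1
    refine hx.trans ?_
    rw [Pi.smul_apply, h1]
    ext ij
    simp [classicalGrad, fderiv_const_smul (hφ.smooth.differentiable (by simp) x)]

/-- The space `X = H¹₀(Ω)^d` of `H¹` fields that vanish on the boundary: the closure of the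
compactly supported smooth fields in `H¹`. -/
noncomputable def X {d : ℕ} (Ω : Set (E d)) : Submodule ℝ (L2 Ω × L2Mat Ω) :=
  H1 Ω ⊓ (testPairs Ω).topologicalClosure

/-- The field in `L²` underlying an element of `X`. -/
def val {d : ℕ} {Ω : Set (E d)} (v : X Ω) : L2 Ω := v.1.1

/-- The (weak) gradient of an element of `X`. -/
def grad {d : ℕ} {Ω : Set (E d)} (v : X Ω) : L2Mat Ω := v.1.2

/-- The space `V` of divergence-free elements of `X`. -/
noncomputable def V {d : ℕ} (Ω : Set (E d)) : Submodule ℝ (X Ω) where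
  carrier := {v | ∀ᵐ x ∂(volume.restrict Ω), ∑ i : Fin d, grad v x (i, i) = 0}
  zero_mem' := by
    have h : ∀ᵐ x ∂(volume.restrict Ω), (0 : L2Mat Ω) x = 0 := Lp.coeFn_zero _ _ _
    filter_upwards [h] with x hx
    refine Finset.sum_eq_zero fun i _ => ?_
    change (0 : L2Mat Ω) x (i, i) = 0
    rw [hx, PiLp.zero_apply]
  add_mem' := by
    intro p q hp hq
    rw [Set.mem_ofPred_eq] at hp hq ⊢
    filter_upwards [Lp.coeFn_add (grad p) (grad q), hp, hq] with x hx h1 h2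
    change ∑ i : Fin d, (grad p + grad q : L2Mat Ω) x (i, i) = 0
    simp only [hx, Pi.add_apply, PiLp.add_apply, Finset.sum_add_distrib, h1, h2, add_zero]
  smul_mem' := by
    intro c p hp
    rw [Set.mem_ofPred_eq] at hp ⊢
    filter_upwards [Lp.coeFn_smul c (grad p), hp] with x hx h1
    change ∑ i : Fin d, (c • grad p : L2Mat Ω) x (i, i) = 0
    simp only [hx, Pi.smul_apply, PiLp.smul_apply, smul_eq_mul, ← Finset.mul_sum, h1, mul_zero]

/-- `a(u, v) = (ν ∇u, ∇v)`. -/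
noncomputable def a {d : ℕ} {Ω : Set (E d)} (ν : ℝ) (u v : X Ω) : ℝ :=
  inner ℝ (ν • grad u) (grad v)

/-- `b(u, w, v) = ((u · ∇) w, v)`. -/
noncomputable def b {d : ℕ} {Ω : Set (E d)} (u w v : X Ω) : ℝ :=
  ∫ x in Ω, ∑ i : Fin d, (∑ j : Fin d, val u x j * grad w x (i, j)) * val v x i

/-- The dual norm `‖f‖_* = sup_{v ∈ V} ⟨f, v⟩ / ‖∇v‖` (with value `0` of the quotient at `v = 0`)
of an element of the dual of `V`. -/
noncomputable def dualNorm {d : ℕ} {Ω : Set (E d)} (f : V Ω →L[ℝ] ℝ) : ℝ :=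
  ⨆ v : V Ω, f v / ‖grad (v : X Ω)‖

/-- `M` is a constant in `b(u, w, v) ≤ M ‖∇u‖ ‖∇w‖ ‖∇v‖`. -/
def TrilinearBound {d : ℕ} (Ω : Set (E d)) (M : ℝ) : Prop :=
  ∀ u w v : X Ω, b u w v ≤ M * ‖grad u‖ * ‖grad w‖ * ‖grad v‖

/-- `M₁` is a constant in `b(u, w, v) ≤ M₁ ‖u‖^{1/2} ‖∇u‖^{1/2} ‖∇w‖ ‖∇v‖`. -/
def TrilinearBoundHalf {d : ℕ} (Ω : Set (E d)) (M₁ : ℝ) : Prop :=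
  ∀ u w v : X Ω, b u w v ≤ M₁ * √‖val u‖ * √‖grad u‖ * ‖grad w‖ * ‖grad v‖

/-- `u ∈ V` is a weak solution of the steady Navier-Stokes equations. -/
def IsNSESolution {d : ℕ} {Ω : Set (E d)} (ν : ℝ) (f : V Ω →L[ℝ] ℝ) (u : V Ω) : Prop :=
  ∀ v : V Ω, a ν (u : X Ω) v + b (u : X Ω) u v = f v

/-- `w ∈ V` is a weak solution of the nudged system with observed state `u`, interpolant `I` and
relaxation parameter `μ`. -/
def IsCDASolution {d : ℕ} {Ω : Set (E d)} (ν μ : ℝ) (I : X Ω →ₗ[ℝ] L2 Ω)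
    (f : V Ω →L[ℝ] ℝ) (u w : V Ω) : Prop :=
  ∀ v : V Ω, a ν (w : X Ω) v + b (w : X Ω) w v + μ * inner ℝ (I w - I u) (I v) = f v

/-- `α = M ν⁻² ‖f‖_*`. -/
noncomputable def alpha {d : ℕ} {Ω : Set (E d)} (M ν : ℝ) (f : V Ω →L[ℝ] ℝ) : ℝ :=
  M * (ν ^ 2)⁻¹ * dualNorm f

end SteadyNSE

open SteadyNSE

open Filter
open scoped ENNReal NNReal Topology

namespace SteadyNSE

theorem norm_fderiv_le_norm_classicalGrad {d : ℕ} (φ : E d → E d) (x : E d) :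
    ‖fderiv ℝ φ x‖ ≤ ‖classicalGrad φ x‖ := by
  refine ContinuousLinearMap.opNorm_le_bound _ (norm_nonneg _) fun v => ?_
  have hv : v = ∑ j, v j • EuclideanSpace.single j (1 : ℝ) := by
    ext i
    simp [Finset.sum_apply, Pi.single_apply]
  have key : ∀ i, (fderiv ℝ φ x v) i = ∑ j, classicalGrad φ x (i, j) * v j := by
    intro i
    conv_lhs => rw [hv]
    simp [classicalGrad, mul_comm]
  rw [← abs_of_nonneg (norm_nonneg (fderiv ℝ φ x v)),
    ← abs_of_nonneg (mul_nonneg (norm_nonneg (classicalGrad φ x)) (norm_nonneg v)), ← sq_le_sq,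
    mul_pow, EuclideanSpace.norm_sq_eq, EuclideanSpace.norm_sq_eq, EuclideanSpace.norm_sq_eq,
    Fintype.sum_prod_type, Finset.sum_mul]
  refine Finset.sum_le_sum fun i _ => ?_
  rw [key i]
  simp only [Real.norm_eq_abs, sq_abs]
  exact Finset.sum_mul_sq_le_sq_mul_sq _ _ _

theorem continuous_classicalGrad {d : ℕ} {φ : E d → E d} (hφ : ContDiff ℝ ∞ φ) :
    Continuous (classicalGrad φ) := by
  have h := hφ.continuous_fderiv (by simp)
  refine (PiLp.continuous_toLp 2 _).comp (continuous_pi fun ij => ?_)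
  exact (EuclideanSpace.proj (𝕜 := ℝ) ij.1).continuous.comp (h.clm_apply continuous_const)

/-- The Sobolev inequality `‖φ‖_{L⁶} ≤ C ‖∇φ‖_{L²}` for test fields on a bounded domain. -/
theorem exists_eLpNorm_six_le_of_isTest {d : ℕ} (hd : d = 2 ∨ d = 3) (Ω : Set (E d))
    (hΩb : Bornology.IsBounded Ω) :
    ∃ C : ℝ≥0, ∀ φ : E d → E d, IsTest Ω φ →
      eLpNorm φ 6 (volume.restrict Ω) ≤ C * eLpNorm (classicalGrad φ) 2 (volume.restrict Ω) := by
  obtain ⟨p, hp1, hpd, hp6, hp2⟩ : ∃ p : ℝ≥0, 1 ≤ p ∧ p < d ∧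
      (p : ℝ)⁻¹ - (d : ℝ)⁻¹ ≤ ((6 : ℝ≥0) : ℝ)⁻¹ ∧ p ≤ 2 := by
    rcases hd with rfl | rfl
    · refine ⟨3 / 2, ?_, ?_, ?_, ?_⟩
      · rw [← NNReal.coe_le_coe]; norm_num
      · rw [← NNReal.coe_lt_coe]; norm_num
      · norm_num
      · rw [← NNReal.coe_le_coe]; norm_num
    · refine ⟨2, ?_, ?_, ?_, le_rfl⟩
      · rw [← NNReal.coe_le_coe]; norm_num
      · rw [← NNReal.coe_lt_coe]; norm_num
      · norm_num
  have hfr : Module.finrank ℝ (E d) = d := by simp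
  have hμ : volume Ω < ⊤ := hΩb.measure_lt_top
  let K : ℝ≥0 := eLpNormLESNormFDerivOfLeConst (E d) (volume : Measure (E d)) Ω p 6
  let t : ℝ≥0∞ := (volume.restrict Ω) Set.univ ^ (1 / (p : ℝ≥0∞).toReal - 1 / (2 : ℝ≥0∞).toReal)
  have ht : t ≠ ⊤ := by
    refine ENNReal.rpow_ne_top_of_nonneg ?_ (by simpa using hμ.ne)
    have : (0 : ℝ) < p := by exact_mod_cast zero_lt_one.trans_le hp1
    have h2 : (p : ℝ) ≤ 2 := by exact_mod_cast hp2
    simp only [ENNReal.coe_toReal, ENNReal.toReal_ofNat, sub_nonneg]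
    gcongr
  refine ⟨K * t.toNNReal, fun φ hφ => ?_⟩
  have hsupp : φ.support ⊆ Ω := (subset_tsupport φ).trans hφ.support
  have hsupp' : (classicalGrad φ).support ⊆ Ω := by
    refine fun x hx => hφ.support (support_fderiv_subset ℝ fun h0 => hx ?_)
    ext ij
    simp [classicalGrad, h0]
  calc eLpNorm φ 6 (volume.restrict Ω) = eLpNorm φ (6 : ℝ≥0) volume := by
        rw [eLpNorm_restrict_eq_of_support_subset hsupp]; rfl
    _ ≤ K * eLpNorm (fderiv ℝ φ) p volume :=
        eLpNorm_le_eLpNorm_fderiv_of_le volume (hφ.smooth.of_le (by simp)) hsupp hp1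
          (by rw [hfr]; exact_mod_cast hpd) (by rw [hfr]; exact hp6) hΩb
    _ ≤ K * eLpNorm (classicalGrad φ) p volume := by
        gcongr
        exact eLpNorm_mono fun x => norm_fderiv_le_norm_classicalGrad φ x
    _ = K * eLpNorm (classicalGrad φ) p (volume.restrict Ω) := by
        rw [eLpNorm_restrict_eq_of_support_subset hsupp']
    _ ≤ K * (eLpNorm (classicalGrad φ) 2 (volume.restrict Ω) * t) := by
        gcongr
        exact eLpNorm_le_eLpNorm_mul_rpow_measure_univ (by exact_mod_cast hp2)
          (continuous_classicalGrad hφ.smooth).aestronglyMeasurable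
    _ = _ := by
        rw [ENNReal.coe_mul, ENNReal.coe_toNNReal ht]; ring

/-- The Sobolev inequality `‖v‖_{L⁶} ≤ C ‖∇v‖_{L²}` on `H¹₀` of a bounded domain. -/
theorem exists_eLpNorm_six_le {d : ℕ} (hd : d = 2 ∨ d = 3) (Ω : Set (E d))
    (hΩb : Bornology.IsBounded Ω) :
    ∃ C : ℝ≥0, ∀ v : X Ω, eLpNorm (val v) 6 (volume.restrict Ω) ≤ C * ‖grad v‖ₑ := by
  obtain ⟨C, hC⟩ := exists_eLpNorm_six_le_of_isTest hd Ω hΩb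
  refine ⟨C, fun v => ?_⟩
  have hv : v.1 ∈ closure (testPairs Ω : Set (L2 Ω × L2Mat Ω)) := v.2.2
  obtain ⟨p, hp, hlim⟩ := mem_closure_iff_seq_limit.1 hv
  have h1 : Tendsto (fun n => (p n).1) atTop (𝓝 (val v)) := (continuous_fst.tendsto _).comp hlim
  have h2 : Tendsto (fun n => (p n).2) atTop (𝓝 (grad v)) := (continuous_snd.tendsto _).comp hlim
  obtain ⟨ns, hns, hae⟩ := (tendstoInMeasure_of_tendsto_Lp h1).exists_seq_tendsto_ae
  have hb : ∀ n, eLpNorm (p n).1 6 (volume.restrict Ω) ≤ C * ‖(p n).2‖ₑ := by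
    intro n
    obtain ⟨φ, hφ, e1, e2⟩ := hp n
    rw [eLpNorm_congr_ae e1, Lp.enorm_def, eLpNorm_congr_ae e2]
    exact hC φ hφ
  have h3 : Tendsto (fun n => (C : ℝ≥0∞) * ‖(p (ns n)).2‖ₑ) atTop (𝓝 (C * ‖grad v‖ₑ)) :=
    ENNReal.Tendsto.const_mul ((h2.comp hns.tendsto_atTop).enorm) (Or.inr ENNReal.coe_ne_top)
  calc eLpNorm (val v) 6 (volume.restrict Ω)
      ≤ liminf (fun n => eLpNorm (p (ns n)).1 6 (volume.restrict Ω)) atTop :=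
        Lp.eLpNorm_lim_le_liminf_eLpNorm (fun n => Lp.aestronglyMeasurable _) _ hae
    _ ≤ liminf (fun n => (C : ℝ≥0∞) * ‖(p (ns n)).2‖ₑ) atTop :=
        liminf_le_liminf (Eventually.of_forall fun n => hb _)
    _ = _ := h3.liminf_eq

/-- The Poincaré inequality on `H¹₀` of a bounded domain. -/
theorem exists_norm_val_le {d : ℕ} (hd : d = 2 ∨ d = 3) (Ω : Set (E d))
    (hΩb : Bornology.IsBounded Ω) :
    ∃ C : ℝ, 0 ≤ C ∧ ∀ v : X Ω, ‖val v‖ ≤ C * ‖grad v‖ := by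
  obtain ⟨C, hC⟩ := exists_eLpNorm_six_le hd Ω hΩb
  have hμ : volume Ω < ⊤ := hΩb.measure_lt_top
  let t : ℝ≥0∞ := (volume.restrict Ω) Set.univ ^ (1 / (2 : ℝ≥0∞).toReal - 1 / (6 : ℝ≥0∞).toReal)
  have ht : t ≠ ⊤ := by
    refine ENNReal.rpow_ne_top_of_nonneg ?_ (by simpa using hμ.ne)
    norm_num
  refine ⟨(C * t).toReal, ENNReal.toReal_nonneg, fun v => ?_⟩
  have h : ‖val v‖ₑ ≤ C * t * ‖grad v‖ₑ := by
    rw [Lp.enorm_def]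
    calc _ ≤ eLpNorm (val v) 6 (volume.restrict Ω) * t :=
          eLpNorm_le_eLpNorm_mul_rpow_measure_univ (by norm_num) (Lp.aestronglyMeasurable _)
      _ ≤ C * ‖grad v‖ₑ * t := by gcongr; exact hC v
      _ = _ := by ring
  have h' := ENNReal.toReal_mono (ENNReal.mul_ne_top (ENNReal.mul_ne_top ENNReal.coe_ne_top ht)
    enorm_ne_top) h
  simpa [ENNReal.toReal_mul] using h'

/-- Hölder's inequality with the interpolation of `L³` between `L²` and `L⁶`. -/
theorem lintegral_enorm_mul_le {α F G K : Type*} [MeasurableSpace α] {μ : Measure α}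
    [NormedAddCommGroup F] [NormedAddCommGroup G] [NormedAddCommGroup K]
    {u : α → F} {g : α → G} {v : α → K} (hu : AEStronglyMeasurable u μ)
    (hg : AEStronglyMeasurable g μ) (hv : AEStronglyMeasurable v μ) :
    ∫⁻ x, ‖u x‖ₑ * ‖g x‖ₑ * ‖v x‖ₑ ∂μ ≤
      eLpNorm u 2 μ ^ (1 / 2 : ℝ) * eLpNorm u 6 μ ^ (1 / 2 : ℝ) * eLpNorm g 2 μ *
        eLpNorm v 6 μ := by
  have key := ENNReal.lintegral_prod_norm_pow_le (μ := μ) (Finset.univ : Finset (Fin 4))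
    (f := ![fun x => ‖u x‖ₑ ^ (2 : ℝ), fun x => ‖u x‖ₑ ^ (6 : ℝ), fun x => ‖g x‖ₑ ^ (2 : ℝ),
      fun x => ‖v x‖ₑ ^ (6 : ℝ)]) (p := ![1 / 4, 1 / 12, 1 / 2, 1 / 6])
    (by
      intro i _
      fin_cases i
      · exact hu.enorm.pow_const _
      · exact hu.enorm.pow_const _
      · exact hg.enorm.pow_const _
      · exact hv.enorm.pow_const _)
    (by simp [Fin.sum_univ_four]; norm_num)
    (by intro i _; fin_cases i <;> norm_num)
  simp only [Fin.prod_univ_four, Matrix.cons_val] at key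
  simp only [eLpNorm_eq_lintegral_rpow_enorm_toReal (p := 2) two_ne_zero ENNReal.ofNat_ne_top,
    eLpNorm_eq_lintegral_rpow_enorm_toReal (p := 6) (by norm_num) ENNReal.ofNat_ne_top,
    ENNReal.toReal_ofNat]
  simp only [← ENNReal.rpow_mul] at key ⊢
  norm_num at key ⊢
  refine le_trans (le_of_eq (lintegral_congr fun x => ?_)) key
  rw [← ENNReal.rpow_add_of_nonneg _ _ (by norm_num) (by norm_num)]
  norm_num

/-- The pointwise bound `|(a · ∇)w · c| ≤ |a| |∇w| |c|`. -/
theorem abs_convection_le {d : ℕ} (a : E d) (G : Mat d) (c : E d) :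
    |∑ i : Fin d, (∑ j : Fin d, a j * G (i, j)) * c i| ≤ ‖a‖ * ‖G‖ * ‖c‖ := by
  refine abs_le_of_sq_le_sq ?_ (by positivity)
  have e1 : ∑ i : Fin d, (∑ j : Fin d, a j * G (i, j)) * c i =
      ∑ ij : Fin d × Fin d, G ij * (a ij.2 * c ij.1) := by
    rw [Fintype.sum_prod_type]
    refine Finset.sum_congr rfl fun i _ => ?_
    rw [Finset.sum_mul]
    exact Finset.sum_congr rfl fun j _ => by ring
  have e2 : ∑ ij : Fin d × Fin d, (a ij.2 * c ij.1) ^ 2 = (∑ j, a j ^ 2) * ∑ i, c i ^ 2 := by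
    rw [Fintype.sum_prod_type, Finset.sum_mul_sum, Finset.sum_comm]
    exact Finset.sum_congr rfl fun i _ => Finset.sum_congr rfl fun j _ => by ring
  rw [e1, mul_pow, mul_pow, EuclideanSpace.norm_sq_eq, EuclideanSpace.norm_sq_eq,
    EuclideanSpace.norm_sq_eq]
  simp only [Real.norm_eq_abs, sq_abs]
  calc _ ≤ _ := Finset.sum_mul_sq_le_sq_mul_sq _ _ _
    _ = _ := by rw [e2]; ring

variable {d : ℕ} {Ω : Set (E d)}

/-- The integrand of `b`. -/
noncomputable def convection (u w v : X Ω) (x : E d) : ℝ :=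
  ∑ i : Fin d, (∑ j : Fin d, val u x j * grad w x (i, j)) * val v x i

theorem aestronglyMeasurable_convection (u w v : X Ω) :
    AEStronglyMeasurable (convection u w v) (volume.restrict Ω) := by
  unfold convection
  refine Finset.aestronglyMeasurable_fun_sum _ fun i _ => ?_
  refine AEStronglyMeasurable.mul ?_ (memLp_coord _ i).1
  exact Finset.aestronglyMeasurable_fun_sum _ fun j _ =>
    (memLp_coord _ j).1.mul (memLp_coord _ (i, j)).1

theorem exists_lintegral_convection_le (hd : d = 2 ∨ d = 3) (hΩb : Bornology.IsBounded Ω) :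
    ∃ C : ℝ≥0, ∀ u w v : X Ω, ∫⁻ x in Ω, ‖convection u w v x‖ₑ ≤
      C * ‖val u‖ₑ ^ (1 / 2 : ℝ) * ‖grad u‖ₑ ^ (1 / 2 : ℝ) * ‖grad w‖ₑ * ‖grad v‖ₑ := by
  obtain ⟨C, hC⟩ := exists_eLpNorm_six_le hd Ω hΩb
  refine ⟨C ^ (1 / 2 : ℝ) * C, fun u w v => ?_⟩
  calc ∫⁻ x in Ω, ‖convection u w v x‖ₑ
      ≤ ∫⁻ x in Ω, ‖val u x‖ₑ * ‖grad w x‖ₑ * ‖val v x‖ₑ := by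
        refine lintegral_mono fun x => ?_
        rw [← enorm_norm (val u x), ← enorm_norm (grad w x), ← enorm_norm (val v x), ← enorm_mul,
          ← enorm_mul]
        refine enorm_le_iff_norm_le.2 ?_
        rw [Real.norm_eq_abs, Real.norm_of_nonneg (by positivity)]
        exact abs_convection_le _ _ _
    _ ≤ _ := lintegral_enorm_mul_le (Lp.aestronglyMeasurable _) (Lp.aestronglyMeasurable _)
        (Lp.aestronglyMeasurable _)
    _ ≤ ‖val u‖ₑ ^ (1 / 2 : ℝ) * (C * ‖grad u‖ₑ) ^ (1 / 2 : ℝ) * ‖grad w‖ₑ *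
        (C * ‖grad v‖ₑ) := by
        gcongr
        · exact (Lp.enorm_def _).ge
        · exact hC u
        · exact (Lp.enorm_def _).ge
        · exact hC v
    _ = _ := by
        rw [ENNReal.mul_rpow_of_nonneg _ _ (by norm_num), ENNReal.coe_mul,
          ENNReal.coe_rpow_of_nonneg _ (by norm_num)]
        ring

theorem integrable_convection (hd : d = 2 ∨ d = 3) (hΩb : Bornology.IsBounded Ω) (u w v : X Ω) :
    Integrable (convection u w v) (volume.restrict Ω) := by
  obtain ⟨C, hC⟩ := exists_lintegral_convection_le (Ω := Ω) hd hΩb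
  refine ⟨aestronglyMeasurable_convection u w v, (hC u w v).trans_lt ?_⟩
  have h (r : ℝ≥0∞) (hr : r ≠ ⊤) : r ^ (1 / 2 : ℝ) < ⊤ :=
    ENNReal.rpow_lt_top_of_nonneg (by norm_num) hr
  exact ENNReal.mul_lt_top (ENNReal.mul_lt_top (ENNReal.mul_lt_top (ENNReal.mul_lt_top
    ENNReal.coe_lt_top (h _ enorm_ne_top)) (h _ enorm_ne_top)) enorm_lt_top) enorm_lt_top

theorem exists_trilinearBoundHalf (hd : d = 2 ∨ d = 3) (hΩb : Bornology.IsBounded Ω) :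
    ∃ M₁ : ℝ, 0 < M₁ ∧ TrilinearBoundHalf Ω M₁ := by
  obtain ⟨C, hC⟩ := exists_lintegral_convection_le (Ω := Ω) hd hΩb
  refine ⟨C + 1, by positivity, fun u w v => ?_⟩
  have h1 : b u w v ≤ (∫⁻ x in Ω, ‖convection u w v x‖ₑ).toReal :=
    (le_abs_self _).trans ((norm_integral_le_lintegral_norm (convection u w v)).trans_eq
      (by simp only [ofReal_norm]))
  have h (r : ℝ≥0∞) (hr : r ≠ ⊤) : r ^ (1 / 2 : ℝ) ≠ ⊤ :=
    ENNReal.rpow_ne_top_of_nonneg (by norm_num) hr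
  have h2 := ENNReal.toReal_mono (ENNReal.mul_ne_top (ENNReal.mul_ne_top (ENNReal.mul_ne_top
    (ENNReal.mul_ne_top ENNReal.coe_ne_top (h _ enorm_ne_top)) (h _ enorm_ne_top)) enorm_ne_top)
    enorm_ne_top) (hC u w v)
  simp only [ENNReal.toReal_mul, ← ENNReal.toReal_rpow, toReal_enorm, ENNReal.coe_toReal,
    ← Real.sqrt_eq_rpow] at h2
  refine (h1.trans h2).trans ?_
  gcongr
  linarith

theorem exists_trilinearBound (hd : d = 2 ∨ d = 3) (hΩb : Bornology.IsBounded Ω) :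
    ∃ M : ℝ, 0 < M ∧ TrilinearBound Ω M := by
  obtain ⟨M₁, hM₁, h⟩ := exists_trilinearBoundHalf (Ω := Ω) hd hΩb
  obtain ⟨C, hC, hP⟩ := exists_norm_val_le hd Ω hΩb
  refine ⟨M₁ * √(C + 1), by positivity, fun u w v => (h u w v).trans ?_⟩
  have h1 : √‖val u‖ ≤ √(C + 1) * √‖grad u‖ := by
    rw [← Real.sqrt_mul (by positivity)]
    exact Real.sqrt_le_sqrt ((hP u).trans (by gcongr; linarith))
  calc M₁ * √‖val u‖ * √‖grad u‖ * ‖grad w‖ * ‖grad v‖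
      ≤ M₁ * (√(C + 1) * √‖grad u‖) * √‖grad u‖ * ‖grad w‖ * ‖grad v‖ := by gcongr
    _ = M₁ * √(C + 1) * (√‖grad u‖ * √‖grad u‖) * ‖grad w‖ * ‖grad v‖ := by ring
    _ = _ := by rw [Real.mul_self_sqrt (norm_nonneg _)]

@[simp] theorem val_sub (u v : X Ω) : val (u - v) = val u - val v := rfl
@[simp] theorem grad_sub (u v : X Ω) : grad (u - v) = grad u - grad v := rfl

theorem b_sub_left (hd : d = 2 ∨ d = 3) (hΩb : Bornology.IsBounded Ω) (u u' w v : X Ω) :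
    b (u - u') w v = b u w v - b u' w v := by
  refine Eq.trans ?_ (integral_sub (integrable_convection hd hΩb u w v)
    (integrable_convection hd hΩb u' w v))
  refine integral_congr_ae ?_
  filter_upwards [Lp.coeFn_sub (val u) (val u')] with x hx
  simp only [val_sub, hx, Pi.sub_apply, PiLp.sub_apply, sub_mul,
    Finset.sum_sub_distrib]

theorem b_sub_mid (hd : d = 2 ∨ d = 3) (hΩb : Bornology.IsBounded Ω) (u w w' v : X Ω) :
    b u (w - w') v = b u w v - b u w' v := by
  refine Eq.trans ?_ (integral_sub (integrable_convection hd hΩb u w v)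
    (integrable_convection hd hΩb u w' v))
  refine integral_congr_ae ?_
  filter_upwards [Lp.coeFn_sub (grad w) (grad w')] with x hx
  simp only [grad_sub, hx, Pi.sub_apply, PiLp.sub_apply, sub_mul, mul_sub,
    Finset.sum_sub_distrib]

theorem b_sub_right (hd : d = 2 ∨ d = 3) (hΩb : Bornology.IsBounded Ω) (u w v v' : X Ω) :
    b u w (v - v') = b u w v - b u w v' := by
  refine Eq.trans ?_ (integral_sub (integrable_convection hd hΩb u w v)
    (integrable_convection hd hΩb u w v'))
  refine integral_congr_ae ?_
  filter_upwards [Lp.coeFn_sub (val v) (val v')] with x hx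
  simp only [val_sub, hx, Pi.sub_apply, PiLp.sub_apply, mul_sub,
    Finset.sum_sub_distrib]

theorem b_neg_right (u w v : X Ω) : b u w (-v) = -b u w v := by
  refine Eq.trans ?_ (integral_neg (convection u w v))
  refine integral_congr_ae ?_
  filter_upwards [Lp.coeFn_neg (val v)] with x hx
  change ∑ i : Fin d, (∑ j : Fin d, val u x j * grad w x (i, j)) * (-val v : L2 Ω) x i = _
  simp only [hx, Pi.neg_apply, PiLp.neg_apply, mul_neg, Finset.sum_neg_distrib]
  rfl

theorem TrilinearBound.abs_le {M : ℝ} (hM : TrilinearBound Ω M) (u w v : X Ω) :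
    |b u w v| ≤ M * ‖grad u‖ * ‖grad w‖ * ‖grad v‖ := by
  refine abs_le'.2 ⟨hM u w v, ?_⟩
  have h := hM u w (-v)
  rw [b_neg_right] at h
  exact h.trans_eq (by rw [show grad (-v) = -grad v from rfl, norm_neg])

theorem TrilinearBoundHalf.neg_le {M₁ : ℝ} (hM : TrilinearBoundHalf Ω M₁) (u w v : X Ω) :
    -b u w v ≤ M₁ * √‖val u‖ * √‖grad u‖ * ‖grad w‖ * ‖grad v‖ := by
  have h := hM u w (-v)
  rw [b_neg_right] at h
  exact h.trans_eq (by rw [show grad (-v) = -grad v from rfl, norm_neg])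

/-- Test fields belong to `X`. -/
theorem testPairs_le_X : testPairs Ω ≤ X Ω := by
  refine le_inf ?_ (Submodule.le_topologicalClosure _)
  rintro p ⟨φ, hφ, h1, h2⟩ ψ hψ i j
  have hφd : Differentiable ℝ φ := hφ.smooth.differentiable (by simp)
  have hψd : Differentiable ℝ ψ := hψ.smooth.differentiable (by simp)
  have hφi : ∀ x, HasFDerivAt (fun x => φ x i)
      ((EuclideanSpace.proj (𝕜 := ℝ) i).comp (fderiv ℝ φ x)) x := fun x =>
    (EuclideanSpace.proj (𝕜 := ℝ) i).hasFDerivAt.comp x (hφd x).hasFDerivAt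
  have hφic : Continuous fun x => φ x i :=
    (EuclideanSpace.proj (𝕜 := ℝ) i).continuous.comp hφ.smooth.continuous
  have hGc : Continuous fun x => classicalGrad φ x (i, j) :=
    (EuclideanSpace.proj (𝕜 := ℝ) (i, j)).continuous.comp (continuous_classicalGrad hφ.smooth)
  have hψc : Continuous (partialDeriv j ψ) :=
    (hψ.smooth.continuous_fderiv (by simp)).clm_apply continuous_const
  have hψs : HasCompactSupport (partialDeriv j ψ) := hψ.compact.fderiv_apply ℝ _
  have hzero : ∀ x, x ∉ Ω → ψ x = 0 := fun x hx =>
    image_eq_zero_of_notMem_tsupport fun h => hx (hψ.support h)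
  have hzero' : ∀ x, x ∉ Ω → partialDeriv j ψ x = 0 := fun x hx => by
    have : fderiv ℝ ψ x = 0 := by
      by_contra h
      exact hx (hψ.support (support_fderiv_subset ℝ h))
    simp [partialDeriv, this]
  have e1 : ∫ x in Ω, p.1 x i * partialDeriv j ψ x = ∫ x, φ x i * partialDeriv j ψ x := by
    refine Eq.trans (integral_congr_ae ?_) (setIntegral_eq_integral_of_forall_compl_eq_zero
      fun x hx => by rw [hzero' x hx, mul_zero])
    filter_upwards [h1] with x hx
    rw [hx]
  have e2 : ∫ x in Ω, p.2 x (i, j) * ψ x = ∫ x, classicalGrad φ x (i, j) * ψ x := by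
    refine Eq.trans (integral_congr_ae ?_) (setIntegral_eq_integral_of_forall_compl_eq_zero
      fun x hx => by rw [hzero x hx, mul_zero])
    filter_upwards [h2] with x hx
    rw [hx]
  rw [e1, e2]
  have key := integral_mul_fderiv_eq_neg_fderiv_mul_of_integrable (μ := (volume : Measure (E d)))
    (f := fun x => φ x i) (g := ψ) (v := EuclideanSpace.single j (1 : ℝ)) ?_ ?_ ?_
    (fun x _ => (hφi x).differentiableAt) (fun x _ => hψd x)
  · refine key.trans (congrArg Neg.neg (integral_congr_ae (Eventually.of_forall fun x => ?_)))
    simp only [(hφi x).fderiv]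
    rfl
  · refine Continuous.integrable_of_hasCompactSupport ?_ (hψ.compact.mul_left)
    refine Continuous.mul ?_ hψ.smooth.continuous
    convert! hGc using 2 with x
    rw [(hφi x).fderiv]
    rfl
  · exact (hφic.mul hψc).integrable_of_hasCompactSupport hψs.mul_left
  · exact (hφic.mul hψ.smooth.continuous).integrable_of_hasCompactSupport hψ.compact.mul_left

theorem IsTest.half_norm_sq {φ : E d → E d} (hφ : IsTest Ω φ) :
    IsTest Ω fun x => (1 / 2 : ℝ) * ‖φ x‖ ^ 2 where
  smooth := contDiff_const.mul (hφ.smooth.norm_sq ℝ)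
  compact := hφ.compact.comp_left (g := fun y : E d => (1 / 2 : ℝ) * ‖y‖ ^ 2) (by simp)
  support := (closure_mono (Function.support_comp_subset
    (g := fun y : E d => (1 / 2 : ℝ) * ‖y‖ ^ 2) (by simp) φ)).trans hφ.support

theorem partialDeriv_half_norm_sq {φ : E d → E d} (hφ : IsTest Ω φ) (j : Fin d) (x : E d) :
    partialDeriv j (fun x => (1 / 2 : ℝ) * ‖φ x‖ ^ 2) x =
      ∑ i, φ x i * classicalGrad φ x (i, j) := by
  have h : HasFDerivAt φ (fderiv ℝ φ x) x :=
    (hφ.smooth.differentiable (by simp) x).hasFDerivAt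
  rw [partialDeriv, (h.norm_sq.const_mul (1 / 2 : ℝ)).fderiv]
  simp [classicalGrad, PiLp.inner_apply, mul_comm]

/-- The convection term of a divergence-free field vanishes on test fields. -/
theorem b_self_eq_zero_of_mem_testPairs (u : V Ω) (p : X Ω) (hp : p.1 ∈ testPairs Ω) :
    b (u : X Ω) p p = 0 := by
  obtain ⟨φ, hφ, h1, h2⟩ := hp
  set ψ : E d → ℝ := fun x => (1 / 2 : ℝ) * ‖φ x‖ ^ 2 with hψdef
  have hψ : IsTest Ω ψ := hφ.half_norm_sq
  have hweak : IsWeakGrad Ω (val (u : X Ω)) (grad (u : X Ω)) := u.1.2.1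
  have hdiv : ∀ᵐ x ∂(volume.restrict Ω), ∑ i : Fin d, grad (u : X Ω) x (i, i) = 0 := u.2
  calc b (u : X Ω) p p
      = ∫ x in Ω, ∑ j, val (u : X Ω) x j * partialDeriv j ψ x := by
        refine integral_congr_ae ?_
        filter_upwards [h1, h2] with x e1 e2
        have e1' : val p x = φ x := e1
        have e2' : grad p x = classicalGrad φ x := e2
        simp only [e1', e2', hψdef, partialDeriv_half_norm_sq hφ, Finset.sum_mul, Finset.mul_sum]
        rw [Finset.sum_comm]
        exact Finset.sum_congr rfl fun j _ => Finset.sum_congr rfl fun i _ => by ring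
    _ = ∑ j, ∫ x in Ω, val (u : X Ω) x j * partialDeriv j ψ x :=
        integral_finsetSum _ fun j _ =>
          (memLp_coord _ j).integrable_mul (hψ.memLp_partialDeriv j)
    _ = ∑ j, -∫ x in Ω, grad (u : X Ω) x (j, j) * ψ x :=
        Finset.sum_congr rfl fun j _ => hweak ψ hψ j j
    _ = -∫ x in Ω, ∑ j, grad (u : X Ω) x (j, j) * ψ x := by
        rw [Finset.sum_neg_distrib]
        exact congrArg Neg.neg (integral_finsetSum _ fun j _ =>
          (memLp_coord (grad (u : X Ω)) (j, j)).integrable_mul hψ.memLp).symm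
    _ = 0 := by
        rw [integral_eq_zero_of_ae, neg_zero]
        filter_upwards [hdiv] with x hx
        rw [← Finset.sum_mul, hx, zero_mul]
        rfl

/-- The convection term of a divergence-free field is skew-symmetric. -/
theorem b_self_eq_zero (hd : d = 2 ∨ d = 3) (hΩb : Bornology.IsBounded Ω) (u : V Ω) (v : X Ω) :
    b (u : X Ω) v v = 0 := by
  obtain ⟨M, hM0, hM⟩ := exists_trilinearBound (Ω := Ω) hd hΩb
  have hv : v.1 ∈ closure (testPairs Ω : Set (L2 Ω × L2Mat Ω)) := v.2.2
  obtain ⟨p, hp, hlim⟩ := mem_closure_iff_seq_limit.1 hv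
  let q : ℕ → X Ω := fun n => ⟨p n, testPairs_le_X (hp n)⟩
  have hq : Tendsto (fun n => grad (q n)) atTop (𝓝 (grad v)) :=
    (continuous_snd.tendsto _).comp hlim
  have hbound : ∀ n, |b (u : X Ω) v v| ≤
      M * ‖grad (u : X Ω)‖ * ‖grad v - grad (q n)‖ * ‖grad v‖ +
        M * ‖grad (u : X Ω)‖ * ‖grad (q n)‖ * ‖grad v - grad (q n)‖ := by
    intro n
    have e : b (u : X Ω) v v = b (u : X Ω) (v - q n) v + b (u : X Ω) (q n) (v - q n) := by
      rw [b_sub_mid hd hΩb, b_sub_right hd hΩb, b_self_eq_zero_of_mem_testPairs u (q n) (hp n)]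
      ring
    rw [e]
    exact (abs_add_le _ _).trans (add_le_add (hM.abs_le _ _ _) (hM.abs_le _ _ _))
  have hdiff : Tendsto (fun n => ‖grad v - grad (q n)‖) atTop (𝓝 0) := by
    simpa using (hq.const_sub (grad v)).norm
  have hz := ((hdiff.const_mul (M * ‖grad (u : X Ω)‖)).mul_const ‖grad v‖).add
    (((hq.norm).const_mul (M * ‖grad (u : X Ω)‖)).mul hdiff)
  have h0 : |b (u : X Ω) v v| ≤ 0 := ge_of_tendsto' (by simpa using hz) hbound
  exact abs_nonpos_iff.1 h0

theorem apply_le_dualNorm_mul (hd : d = 2 ∨ d = 3) (hΩb : Bornology.IsBounded Ω)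
    (f : V Ω →L[ℝ] ℝ) (v : V Ω) : f v ≤ dualNorm f * ‖grad (v : X Ω)‖ := by
  obtain ⟨C, hC, hP⟩ := exists_norm_val_le hd Ω hΩb
  obtain ⟨K, hK, hfK⟩ : ∃ K : ℝ, 0 < K ∧ ∀ v : V Ω, ‖f v‖ ≤ K * ‖v‖ :=
    @ContinuousLinearMap.bound ℝ ℝ (V Ω) ℝ _ _ _ _ _ _ (RingHom.id ℝ) _ f
  have hf : ∀ v : V Ω, f v ≤ K * (C + 1) * ‖grad (v : X Ω)‖ := by
    intro v
    have hv : ‖v‖ ≤ (C + 1) * ‖grad (v : X Ω)‖ := by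
      change max ‖val (v : X Ω)‖ ‖grad (v : X Ω)‖ ≤ _
      have := hP v
      have := norm_nonneg (grad (v : X Ω))
      exact max_le (by nlinarith) (by nlinarith)
    calc f v ≤ ‖f v‖ := le_abs_self _
      _ ≤ K * ‖v‖ := hfK v
      _ ≤ K * ((C + 1) * ‖grad (v : X Ω)‖) := by gcongr
      _ = _ := by ring
  rcases (norm_nonneg (grad (v : X Ω))).eq_or_lt with h | h
  · simpa [← h] using hf v
  · rw [← div_le_iff₀ h]
    refine le_ciSup (f := fun v : V Ω => f v / ‖grad (v : X Ω)‖) ⟨K * (C + 1), ?_⟩ v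
    rintro _ ⟨w, rfl⟩
    exact div_le_of_le_mul₀ (norm_nonneg _) (by positivity) (hf w)

theorem a_self (ν : ℝ) (u : X Ω) : a ν u u = ν * ‖grad u‖ ^ 2 := by
  rw [a, real_inner_smul_left, real_inner_self_eq_norm_sq]

/-- The a priori bound `ν ‖∇u‖ ≤ ‖f‖_*`. -/
theorem IsNSESolution.norm_grad_le (hd : d = 2 ∨ d = 3) (hΩb : Bornology.IsBounded Ω) {ν : ℝ}
    {f : V Ω →L[ℝ] ℝ} {u : V Ω} (hu : IsNSESolution ν f u) :
    ν * ‖grad (u : X Ω)‖ ≤ dualNorm f := by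
  have h := hu u
  rw [a_self, b_self_eq_zero hd hΩb, add_zero] at h
  have h1 := apply_le_dualNorm_mul hd hΩb f u
  rcases (norm_nonneg (grad (u : X Ω))).eq_or_lt with h0 | h0
  · rw [← h0, mul_zero]
    exact Real.iSup_nonneg' ⟨0, by simp⟩
  · exact le_of_mul_le_mul_right (by linarith [sq ‖grad (u : X Ω)‖]) h0

/-- The error equation tested with the error. -/
theorem IsCDASolution.energy_eq (hd : d = 2 ∨ d = 3) (hΩb : Bornology.IsBounded Ω) {ν μ : ℝ}
    {I : X Ω →ₗ[ℝ] L2 Ω} {f : V Ω →L[ℝ] ℝ} {u w : V Ω} (hu : IsNSESolution ν f u)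
    (hw : IsCDASolution ν μ I f u w) :
    ν * ‖grad (w - u : X Ω)‖ ^ 2 + μ * ‖I (w - u : X Ω)‖ ^ 2 =
      -b (w - u : X Ω) (u : X Ω) (w - u : X Ω) := by
  have h1 := hw (w - u)
  have h2 := hu (w - u)
  have h3 := b_self_eq_zero hd hΩb w (w - u : X Ω)
  rw [b_sub_mid hd hΩb] at h3
  rw [b_sub_left hd hΩb, ← a_self, ← real_inner_self_eq_norm_sq, map_sub]
  have h4 : a ν (w - u : X Ω) (w - u : X Ω) =
      a ν (w : X Ω) (w - u : X Ω) - a ν (u : X Ω) (w - u : X Ω) := by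
    rw [a, a, a, grad_sub, smul_sub, inner_sub_left]
  simp only [AddSubgroupClass.coe_sub, map_sub] at h1 h2
  linarith

theorem eq_of_norm_grad_sub_eq_zero (hd : d = 2 ∨ d = 3) (hΩb : Bornology.IsBounded Ω)
    {u w : V Ω} (h : ‖grad (w - u : X Ω)‖ = 0) : w = u := by
  obtain ⟨C, hC, hP⟩ := exists_norm_val_le hd Ω hΩb
  have h1 : ‖val (w - u : X Ω)‖ = 0 :=
    le_antisymm ((hP _).trans_eq (by rw [h, mul_zero])) (norm_nonneg _)
  rw [← sub_eq_zero]
  refine Subtype.ext (Subtype.ext (Prod.ext ?_ ?_))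
  · exact norm_eq_zero.1 h1
  · exact norm_eq_zero.1 h

/-- A quartic inequality that forces `t = 0`. -/
theorem eq_zero_of_quartic_le {r t : ℝ} (h : 3 / 4 * t ^ 4 + 27 / 32 * r ^ 4 ≤ r * t ^ 3) :
    t = 0 := by
  have h1 : 0 ≤ 1 / 2 * t ^ 4 + 27 / 32 * r ^ 4 - r * t ^ 3 := by
    have : 1 / 2 * t ^ 4 + 27 / 32 * r ^ 4 - r * t ^ 3 =
        1 / 96 * (3 * r - 2 * t) ^ 2 * ((3 * r + 2 * t) ^ 2 + 8 * t ^ 2) := by ring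
    rw [this]
    positivity
  have h2 : t ^ 4 ≤ 0 := by linarith
  exact pow_eq_zero_iff (n := 4) (by norm_num) |>.1 (le_antisymm h2 (by positivity))

theorem isCDASolution_self {ν : ℝ} (μ : ℝ) (I : X Ω →ₗ[ℝ] L2 Ω) {f : V Ω →L[ℝ] ℝ} {u : V Ω}
    (hu : IsNSESolution ν f u) : IsCDASolution ν μ I f u u := by
  intro v
  rw [sub_self, inner_zero_left, mul_zero, add_zero]
  exact hu v

/-- `M ‖∇u‖ ≤ α ν`. -/
theorem IsNSESolution.mul_norm_grad_le (hd : d = 2 ∨ d = 3) (hΩb : Bornology.IsBounded Ω)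
    {M ν : ℝ} (hM : 0 < M) (hν : 0 < ν) {f : V Ω →L[ℝ] ℝ} {u : V Ω}
    (hu : IsNSESolution ν f u) : M * ‖grad (u : X Ω)‖ ≤ alpha M ν f * ν := by
  have h : alpha M ν f * ν = M * (dualNorm f / ν) := by
    rw [alpha]
    field_simp
  rw [h]
  gcongr
  rw [le_div_iff₀ hν, mul_comm]
  exact hu.norm_grad_le hd hΩb

/-- Uniqueness for small data. -/
theorem IsCDASolution.eq_of_alpha_lt_one (hd : d = 2 ∨ d = 3) (hΩb : Bornology.IsBounded Ω)
    {M ν μ : ℝ} (hM0 : 0 < M) (hM : TrilinearBound Ω M) (hν : 0 < ν) (hμ : 0 ≤ μ)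
    {I : X Ω →ₗ[ℝ] L2 Ω} {f : V Ω →L[ℝ] ℝ} {u w : V Ω} (hu : IsNSESolution ν f u)
    (hα : alpha M ν f < 1) (hw : IsCDASolution ν μ I f u w) : w = u := by
  refine eq_of_norm_grad_sub_eq_zero hd hΩb ?_
  have h1 := hw.energy_eq hd hΩb hu
  have h2 := (neg_le_abs _).trans (hM.abs_le (w - u : X Ω) (u : X Ω) (w - u : X Ω))
  have h3 := hu.mul_norm_grad_le hd hΩb hM0 hν
  set e : X Ω := w - u
  have h4 : 0 ≤ μ * ‖I e‖ ^ 2 := by positivity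
  have h5 : M * ‖grad e‖ * ‖grad (u : X Ω)‖ * ‖grad e‖ ≤ alpha M ν f * ν * ‖grad e‖ ^ 2 := by
    calc _ = M * ‖grad (u : X Ω)‖ * ‖grad e‖ ^ 2 := by ring
      _ ≤ _ := by gcongr
  have h6 : (1 - alpha M ν f) * ν * ‖grad e‖ ^ 2 ≤ 0 := by linarith
  have h7 : 0 < (1 - alpha M ν f) * ν := mul_pos (sub_pos.2 hα) hν
  have h8 : ‖grad e‖ ^ 2 ≤ 0 := nonpos_of_mul_nonpos_right h6 h7
  exact pow_eq_zero_iff two_ne_zero |>.1 (le_antisymm h8 (sq_nonneg _))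

/-- Uniqueness for large data, with fine enough observations and strong enough nudging. -/
theorem IsCDASolution.eq_of_nudging (hd : d = 2 ∨ d = 3) (hΩb : Bornology.IsBounded Ω)
    {M M₁ ν μ C_I H : ℝ} (hM0 : 0 < M) (hM₁0 : 0 < M₁) (hM₁ : TrilinearBoundHalf Ω M₁)
    (hν : 0 < ν) (hC : 0 < C_I) (hH : 0 < H) {I : X Ω →ₗ[ℝ] L2 Ω}
    (hI : ∀ v : X Ω, ‖I v - val v‖ ≤ C_I * H * ‖grad v‖)
    {f : V Ω →L[ℝ] ℝ} {u w : V Ω} (hu : IsNSESolution ν f u) (hα : 0 < alpha M ν f)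
    (hHα : H ≤ 2 * M ^ 2 / (3 * √3 * C_I * M₁ ^ 2 * alpha M ν f ^ 2))
    (hμ : ν / (4 * C_I ^ 2 * H ^ 2) ≤ μ) (hw : IsCDASolution ν μ I f u w) : w = u := by
  refine eq_of_norm_grad_sub_eq_zero hd hΩb ?_
  have h1 := hw.energy_eq hd hΩb hu
  have h2 := hM₁.neg_le (w - u : X Ω) (u : X Ω) (w - u : X Ω)
  have h3 := hu.mul_norm_grad_le hd hΩb hM0 hν
  have h4 := hI (w - u : X Ω)
  set e : X Ω := w - u
  set α := alpha M ν f
  set s := √‖val e‖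
  set t := √‖grad e‖
  have hs2 : ‖val e‖ = s ^ 2 := (Real.sq_sqrt (norm_nonneg _)).symm
  have ht2 : ‖grad e‖ = t ^ 2 := (Real.sq_sqrt (norm_nonneg _)).symm
  have hs0 : 0 ≤ s := Real.sqrt_nonneg _
  have ht0 : 0 ≤ t := Real.sqrt_nonneg _
  set h := C_I * H with hh
  have hh0 : 0 < h := mul_pos hC hH
  set K := M₁ * α / M with hK
  have hK0 : 0 < K := by positivity
  have hhK : 27 * (h ^ 2 * K ^ 4) ≤ 4 := by
    have e1 : 3 * √3 * (h * K ^ 2) ≤ 2 := by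
      rw [le_div_iff₀ (by positivity)] at hHα
      rw [hK, div_pow, hh, mul_div_assoc', mul_div_assoc', div_le_iff₀ (by positivity)]
      linarith
    have e2 : (3 * √3 * (h * K ^ 2)) ^ 2 ≤ 2 ^ 2 := pow_le_pow_left₀ (by positivity) e1 2
    have e3 : √3 ^ 2 = 3 := Real.sq_sqrt (by norm_num)
    have e4 : (3 * √3 * (h * K ^ 2)) ^ 2 = 9 * √3 ^ 2 * (h ^ 2 * K ^ 4) := by ring
    rw [e4, e3] at e2
    linarith
  have hval : ‖val e‖ ^ 2 ≤ 2 * ‖I e‖ ^ 2 + 2 * h ^ 2 * ‖grad e‖ ^ 2 := by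
    have e1 : ‖val e‖ ≤ ‖I e‖ + h * ‖grad e‖ := by
      calc ‖val e‖ = ‖I e - (I e - val e)‖ := by rw [sub_sub_cancel]
        _ ≤ ‖I e‖ + ‖I e - val e‖ := norm_sub_le _ _
        _ ≤ _ := by gcongr
    calc ‖val e‖ ^ 2 ≤ (‖I e‖ + h * ‖grad e‖) ^ 2 := by gcongr
      _ ≤ _ := by linarith [sq_nonneg (‖I e‖ - h * ‖grad e‖)]
  have hnudge : ν * (‖val e‖ ^ 2 / (8 * h ^ 2)) ≤ μ * ‖I e‖ ^ 2 + ν * (‖grad e‖ ^ 2 / 4) := by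
    have e1 : ν / (4 * C_I ^ 2 * H ^ 2) * ‖I e‖ ^ 2 ≤ μ * ‖I e‖ ^ 2 := by gcongr
    have e2 : ν * (‖val e‖ ^ 2 / (8 * h ^ 2)) ≤
        ν * ((2 * ‖I e‖ ^ 2 + 2 * h ^ 2 * ‖grad e‖ ^ 2) / (8 * h ^ 2)) := by gcongr
    have e3 : ν * ((2 * ‖I e‖ ^ 2 + 2 * h ^ 2 * ‖grad e‖ ^ 2) / (8 * h ^ 2)) =
        ν / (4 * C_I ^ 2 * H ^ 2) * ‖I e‖ ^ 2 + ν * (‖grad e‖ ^ 2 / 4) := by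
      rw [hh]
      field_simp
      ring
    linarith
  have hconv : M₁ * s * t * ‖grad (u : X Ω)‖ * ‖grad e‖ ≤ ν * (K * s * t ^ 3) := by
    have e1 : ‖grad (u : X Ω)‖ ≤ α * ν / M := by rwa [le_div_iff₀ hM0, mul_comm]
    calc _ ≤ M₁ * s * t * (α * ν / M) * ‖grad e‖ := by gcongr
      _ = _ := by rw [ht2, hK]; ring
  have hcoef : 27 / 32 * K ^ 4 ≤ 1 / (8 * h ^ 2) := by
    rw [le_div_iff₀ (by positivity)]
    linarith
  have hquart : ν * (3 / 4 * t ^ 4 + s ^ 4 / (8 * h ^ 2)) ≤ ν * (K * s * t ^ 3) := by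
    have e1 := (h1.le.trans h2).trans hconv
    rw [hs2, ht2, ← pow_mul, ← pow_mul] at hnudge
    rw [ht2, ← pow_mul] at e1
    have e2 : ν * (s ^ 4 / (8 * h ^ 2)) ≤ μ * ‖I e‖ ^ 2 + ν * (t ^ 4 / 4) := hnudge
    have e3 : ν * t ^ 4 + μ * ‖I e‖ ^ 2 ≤ ν * (K * s * t ^ 3) := e1
    generalize s ^ 4 / (8 * h ^ 2) = z at e2 e3 ⊢
    generalize μ * ‖I e‖ ^ 2 = y at e2 e3 ⊢
    linarith only [e2, e3]
  have hquart' := le_of_mul_le_mul_left hquart hν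
  have hfin : 3 / 4 * t ^ 4 + 27 / 32 * (K * s) ^ 4 ≤ (K * s) * t ^ 3 := by
    refine le_trans ?_ hquart'
    have := mul_le_mul_of_nonneg_right hcoef (pow_nonneg hs0 4)
    rw [mul_pow, div_eq_mul_one_div (s ^ 4)]
    linarith
  rw [ht2, eq_zero_of_quartic_le hfin]
  norm_num

end SteadyNSE

theorem theorem1 {d : ℕ} (hd : d = 2 ∨ d = 3) (Ω : Set (E d)) (hΩ : IsOpen Ω)
    (hΩb : Bornology.IsBounded Ω) :
    (∃ M : ℝ, 0 < M ∧ TrilinearBound Ω M) ∧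
    (∃ M₁ : ℝ, 0 < M₁ ∧ TrilinearBoundHalf Ω M₁) ∧
    ∀ M M₁ : ℝ, 0 < M → TrilinearBound Ω M → 0 < M₁ → TrilinearBoundHalf Ω M₁ →
    ∀ ν : ℝ, 0 < ν → ∀ (f : V Ω →L[ℝ] ℝ) (u : V Ω), IsNSESolution ν f u →
    ∀ (C_I H μ : ℝ), 0 < C_I → 0 < H → 0 ≤ μ →
    ∀ I_H : X Ω →ₗ[ℝ] L2 Ω, (∀ v : X Ω, ‖I_H v - val v‖ ≤ C_I * H * ‖grad v‖) →
      (alpha M ν f < 1 →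
        IsCDASolution ν μ I_H f u u ∧ ∀ w : V Ω, IsCDASolution ν μ I_H f u w → w = u) ∧
      (1 ≤ alpha M ν f →
        H ≤ 2 * M ^ 2 / (3 * √3 * C_I * M₁ ^ 2 * alpha M ν f ^ 2) →
        ν / (4 * C_I ^ 2 * H ^ 2) ≤ μ →
        IsCDASolution ν μ I_H f u u ∧ ∀ w : V Ω, IsCDASolution ν μ I_H f u w → w = u) := by
  refine ⟨exists_trilinearBound hd hΩb, exists_trilinearBoundHalf hd hΩb, ?_⟩
  intro M M₁ hM0 hM hM₁0 hM₁ ν hν f u hu C_I H μ hC hH hμ I hI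
  refine ⟨fun hα => ⟨isCDASolution_self μ I hu, fun w hw => ?_⟩,
    fun hα hHα hμν => ⟨isCDASolution_self μ I hu, fun w hw => ?_⟩⟩
  · exact hw.eq_of_alpha_lt_one hd hΩb hM0 hM hν hμ hu hα
  · exact hw.eq_of_nudging hd hΩb hM0 hM₁0 hM₁ hν hC hH hI hu (zero_lt_one.trans_le hα) hHα hμν
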